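/- Let $K$ be an $\omega$-stable first-order structure, that is: for every structure $N$ elementarily equivalent to $K$, every countable $A\subseteq N$ and every $k$, there are only countably many complete $k$-types over $A$. Let $X\subseteq K^n$ be a trivial strictly minimal set defined over a set $A\subseteq K$. This means the following, where algebraic closure is taken in $K$, tuples lie in $\operatorname{acl}(\cdot)$ coordinatewise, and a set of tuples used as parameters stands for the set of all their coordinates: - $X$ is strongly minimal and defined over $A$: it is infinite, defined by a formula $\varphi$ with parameters from $A$, and for every elementary extension $N$ of $K$, every subset of $\varphi(N)$ definable with parameters from $N$ is finite or cofinite in $\varphi(N)$; - $X$ is strictly minimal over $A$: $X\cap\operatorname{acl}(A)=\emptyset$, and $\operatorname{acl}(A\cup\{a\})\cap X=\{a\}$ for all $a\in X$; - $X$ is trivial: $\operatorname{acl}(A\cup B)\cap X=\bigcup_{b\in B}\bigl(\operatorname{acl}(A\cup\{b\})\cap X\bigr)$ for every nonempty $B\subseteq X$. Call an equivalence relation on $X$ *trivial* if it is definable (with parameters from $X$) in the pure language of equality; equivalently, either it has a cofinite class, or all but finitely many elements of $X$ lie in classes of size $1$. Then no non-trivial equivalence relation on $X$ is definable in $K$ with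 parameters from $K$: every equivalence relation $E$ on $X$ that is definable in $K$ with arbitrary parameters from $K$ is trivial. -/

import Mathlib

open FirstOrder

universe u v w

namespace OmegaStable

section Definitions

/-- The structure `K` is ω-stable: for every structure `N` elementarily equivalent to `K`, every
countable set `A` of elements of `N` and every `k`, there are only countably many complete
`k`-types over `A`, i.e. complete `k`-types of the elementary diagram of `A` in `N`. -/
def IsOmegaStable (L : FirstOrder.Language.{u, v}) (K : Type w) [L.Structure K] : Prop :=
  ∀ (N : Type (max u v w)) [L.Structure N], L.ElementarilyEquivalent K N →
    ∀ A : Set N, A.Countable → ∀ k : ℕ,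
      Countable ((L[[A]].completeTheory N).CompleteType (Fin k))

variable (L : FirstOrder.Language.{u, v}) {K : Type w} [L.Structure K]

/-- The model-theoretic algebraic closure of `A` in `K`: the union of all finite subsets of `K`
that are definable with parameters from `A`. -/
def acl (A : Set K) : Set K :=
  {b | ∃ S : Set K, A.Definable₁ L S ∧ S.Finite ∧ b ∈ S}

/-- The set of all coordinates of the members of a set of tuples. -/
def coords {n : ℕ} (B : Set (Fin n → K)) : Set K :=
  {c | ∃ b ∈ B, ∃ i, b i = c}

/-- `acl(A ∪ B) ∩ X` for sets of tuples `B`, `X`: a tuple lies in an algebraic closure when all its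
coordinates do, and a set of tuples contributes all of its coordinates as parameters. -/
def aclIn (A : Set K) {n : ℕ} (X B : Set (Fin n → K)) : Set (Fin n → K) :=
  {x | x ∈ X ∧ ∀ i, x i ∈ acl L (A ∪ coords B)}

/-- `X ⊆ Kⁿ` is strongly minimal and defined over `A`: it is infinite, it is defined by a formula
`φ` with parameters from `A`, and in every elementary extension `N` of `K`, every subset of
`φ(N)` that is definable (with arbitrary parameters from `N`) is finite or cofinite in `φ(N)`. -/
def IsStronglyMinimal (A : Set K) {n : ℕ} (X : Set (Fin n → K)) : Prop :=
  X.Infinite ∧ ∃ φ : L.Formula (A ⊕ Fin n),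
    X = {x | φ.Realize (Sum.elim (fun a : A => (a : K)) x)} ∧
    ∀ (N : Type (max u v w)) [L.Structure N] (f : K ↪ₑ[L] N) (Y : Set (Fin n → N)),
      Y ⊆ {x | φ.Realize (Sum.elim (fun a : A => f a) x)} →
      (Set.univ : Set N).Definable L Y →
      Y.Finite ∨ ({x | φ.Realize (Sum.elim (fun a : A => f a) x)} \ Y).Finite

/-- `X` is strictly minimal over `A`: it is strongly minimal and defined over `A`,
`acl(A) ∩ X = ∅`, and `acl(aA) ∩ X = {a}` for all `a ∈ X`. -/
def IsStrictlyMinimal (A : Set K) {n : ℕ} (X : Set (Fin n → K)) : Prop :=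
  IsStronglyMinimal L A X ∧ aclIn L A X ∅ = ∅ ∧ ∀ a ∈ X, aclIn L A X {a} = {a}

/-- The pregeometry `B ↦ acl(A ∪ B) ∩ X` on `X` is trivial: the closure of a nonempty set is the
union of the closures of its points. -/
def HasTrivialGeometry (A : Set K) {n : ℕ} (X : Set (Fin n → K)) : Prop :=
  ∀ B ⊆ X, B.Nonempty → aclIn L A X B = ⋃ b ∈ B, aclIn L A X {b}

/-- The binary relation `E` on `X ⊆ Kⁿ` is definable in `K` with arbitrary parameters from `K`,
as a subset of `Kⁿ × Kⁿ`. -/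
def RelDefinable {n : ℕ} {X : Set (Fin n → K)} (E : X → X → Prop) : Prop :=
  (Set.univ : Set K).Definable L
    {z : Fin n ⊕ Fin n → K | ∃ (hx : z ∘ Sum.inl ∈ X) (hy : z ∘ Sum.inr ∈ X),
      E ⟨z ∘ Sum.inl, hx⟩ ⟨z ∘ Sum.inr, hy⟩}

end Definitions

/-- A relation on a set `S` is trivial if it is definable, with parameters from `S`, in the pure
language of equality (the language without non-logical symbols). -/
def IsTrivialRel {S : Type w} (E : S → S → Prop) : Prop :=
  letI : FirstOrder.Language.empty.Structure S := FirstOrder.Language.emptyStructure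
  (Set.univ : Set S).Definable₂ FirstOrder.Language.empty {p : S × S | E p.1 p.2}

end OmegaStable

/-! A trivial strictly minimal set is an indiscernible set over `A`: tuples of distinct elements of
equal length satisfy the same formulas over `A` (`mem_of_injective`). Indeed a finite set in `X`
definable over `A` and `B ⊆ X` lies in `B`, and every definable subset of `X` is finite or cofinite.

Suppose `E` is not trivial. No class is cofinite, so by strong minimality all classes are finite;
hence infinitely many of them are not singletons, and there are pairs of distinct equivalent
elements in infinitely many classes. Write `E a b` as `D (z₀, a, b)` with `D` definable without
parameters. For any finite pattern there are pairs of elements of `X`, all distinct, on which `D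
(z₀, ·, ·)` follows that pattern. By indiscernibility one fixed sequence of pairs then admits, for
each finite pattern, some `z` realizing it. The formulas `D (z, aᵢ, bᵢ)` are therefore independent
and yield continuum many types over a countable set, contradicting ω-stability
(`IsOmegaStable.not_independent`). -/

namespace OmegaStable

open Set FirstOrder.Language

/-! ### Fibres, isomorphic images and coordinates of definable sets. -/

section DefinableSets

variable {L : FirstOrder.Language.{u, v}} {K : Type w} [L.Structure K]

/-- The fibre of a definable set over a tuple is definable once the tuple is named. -/
theorem definable_fiber {A : Set K} {α β : Type*} {D : Set (α ⊕ β → K)}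
    (hD : A.Definable L D) (b : β → K) :
    (A ∪ range b).Definable L {x : α → K | Sum.elim x b ∈ D} := by
  obtain ⟨φ, rfl⟩ := definable_iff_exists_formula_sum.1 hD
  refine definable_iff_exists_formula_sum.2 ⟨φ.relabel (Sum.elim
    (fun a : A => Sum.inl ⟨a, Or.inl a.2⟩)
    (Sum.elim Sum.inr fun j => Sum.inl ⟨b j, Or.inr ⟨j, rfl⟩⟩)), ?_⟩
  ext x
  simp only [mem_ofPred_eq, Formula.realize_relabel]
  congr! 1
  funext c
  rcases c with c | c | c <;> rfl

/-- An isomorphism carries definable sets to definable sets. -/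
theorem definable_image_equiv {N : Type*} [L.Structure N] (e : K ≃[L] N) {A : Set K} {α : Type*}
    {Z : Set (α → K)} (hZ : A.Definable L Z) :
    (e '' A).Definable L ((fun v : α → K => e ∘ v) '' Z) := by
  obtain ⟨φ, rfl⟩ := definable_iff_exists_formula_sum.1 hZ
  refine definable_iff_exists_formula_sum.2 ⟨φ.relabel (Sum.map
    (fun a : A => ⟨e a, mem_image_of_mem e a.2⟩) id), ?_⟩
  have key : ∀ v : α → K, (φ.relabel (Sum.map
      (fun a : A => (⟨e a, mem_image_of_mem e a.2⟩ : e '' A)) id)).Realize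
        (Sum.elim (fun a : e '' A => (a : N)) (e ∘ v)) ↔
      φ.Realize (Sum.elim (fun a : A => (a : K)) v) := by
    intro v
    rw [Formula.realize_relabel, ← StrongHomClass.realize_formula e φ]
    congr! 1
    funext c
    rcases c with c | c <;> rfl
  ext y
  simp only [mem_image, mem_ofPred_eq]
  constructor
  · rintro ⟨v, hv, rfl⟩
    exact (key v).2 hv
  · intro hy
    have h : e ∘ (e.symm ∘ y) = y := by
      funext i
      simp
    exact ⟨e.symm ∘ y, (key _).1 (by rwa [h]), h⟩

/-- The coordinates of the members of a finite definable set are algebraic. -/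
theorem mem_acl_of_finite_definable {A : Set K} {n : ℕ} {Y : Set (Fin n → K)}
    (hY : A.Definable L Y) (hfin : Y.Finite) {x : Fin n → K} (hx : x ∈ Y) (i : Fin n) :
    x i ∈ acl L A := by
  refine ⟨(fun y : Fin n → K => y i) '' Y, ?_, hfin.image _, mem_image_of_mem _ hx⟩
  have h := hY.image_comp (fun _ : Fin 1 => i)
  unfold Definable₁
  convert! h using 1
  ext v
  simp only [mem_image, mem_ofPred_eq]
  constructor
  · rintro ⟨y, hy, h⟩
    refine ⟨y, hy, ?_⟩
    funext j
    rw [Subsingleton.elim j 0]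
    exact h
  · rintro ⟨y, hy, rfl⟩
    exact ⟨y, hy, rfl⟩

end DefinableSets

/-! ### Independent formulas and the number of types. -/

section OmegaStability

/-- A sequence of formulas all of whose finite Boolean combinations are realized gives
uncountably many complete types. -/
theorem not_countable_completeType {L : FirstOrder.Language} {M : Type*} [L.Structure M]
    [Nonempty M] {T : L.Theory} [M ⊨ T] {α : Type*} (ψ : ℕ → L.Formula α)
    (h : ∀ (S : Set ℕ) (F : Finset ℕ), ∃ v : α → M, ∀ i ∈ F, (ψ i).Realize v ↔ i ∈ S) :
    ¬ Countable (T.CompleteType α) := by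
  classical
  have key : ∀ S : Set ℕ, ∃ p : T.CompleteType α, ∀ i, Formula.equivSentence (ψ i) ∈ p ↔ i ∈ S := by
    intro S
    let θ : ℕ → L[[α]].Sentence := fun i =>
      Formula.equivSentence (if i ∈ S then ψ i else (ψ i).not)
    -- Compactness: each finite part of the pattern `S` lies in the type of a realizing tuple of
    -- `M`.
    have hne : {p : T.CompleteType α | (⋃ F : Finset ℕ, θ '' F) ⊆ (p : L[[α]].Theory)} ≠ ∅ := by
      rw [Ne, Theory.CompleteType.setOfPred_subset_eq_empty_iff, not_not, union_iUnion,
        Theory.isSatisfiable_directed_union_iff]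
      · intro F
        obtain ⟨v, hv⟩ := h S F
        refine (T.typeOf v).isMaximal.1.mono (union_subset (T.typeOf v).subset ?_)
        rintro _ ⟨i, hi, rfl⟩
        refine Theory.CompleteType.formula_mem_typeOf.2 ?_
        have := hv i hi
        split_ifs with hS
        · exact this.2 hS
        · exact fun hr => hS (this.1 hr)
      · intro F G
        exact ⟨F ∪ G, union_subset_union_right _ (image_mono (by simp)),
          union_subset_union_right _ (image_mono (by simp))⟩
    obtain ⟨p, hp⟩ := nonempty_iff_ne_empty.2 hne
    refine ⟨p, fun i => ?_⟩
    have hi : θ i ∈ p := hp (mem_iUnion.2 ⟨{i}, i, by simp, rfl⟩)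
    by_cases hS : i ∈ S
    · simpa [θ, hS] using hi
    · simp only [θ, hS, if_false, Formula.equivSentence_not] at hi
      simpa [hS] using (p.not_mem_iff _).1 hi
  choose p hp using key
  intro hc
  have hinj : Function.Injective p := fun S S' hSS => by
    ext i
    rw [← hp S i, ← hp S' i, hSS]
  obtain ⟨f, hf⟩ := exists_injective_nat (T.CompleteType α)
  exact Function.cantor_injective (f ∘ p) (hf.comp hinj)

variable {L : FirstOrder.Language.{u, v}} {K : Type w} [L.Structure K]

/-- An ω-stable structure has no independent sequence of sets definable over countably many
parameters. -/
theorem IsOmegaStable.not_independent (hK : IsOmegaStable L K) [Nonempty K] {C : Set K}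
    (hC : C.Countable) {k : ℕ} {Z : ℕ → Set (Fin k → K)} (hZ : ∀ i, C.Definable L (Z i))
    (h : ∀ (S : Set ℕ) (F : Finset ℕ), ∃ v, ∀ i ∈ F, v ∈ Z i ↔ i ∈ S) : False := by
  -- ω-stability speaks of structures in `Type (max u v w)`, so `K` is replaced by an isomorphic
  -- copy there.
  let N : Type (max u v w) := ULift.{max u v} K
  let e₀ : K ≃ N := Equiv.ulift.symm
  let : L.Structure N := e₀.inducedStructure
  let e : K ≃[L] N := e₀.inducedStructureEquiv
  choose ψ hψ using fun i => definable_image_equiv e (hZ i)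
  have : Nonempty N := ⟨e (Classical.arbitrary K)⟩
  refine not_countable_completeType (M := N) (T := (L[[e '' C]]).completeTheory N) ψ ?_
    (hK N e.toElementaryEmbedding.elementarilyEquivalent (e '' C) (hC.image e) k)
  intro S F
  obtain ⟨v, hv⟩ := h S F
  refine ⟨e ∘ v, fun i hi => ?_⟩
  rw [← hv i hi, ← (e.injective.comp_left).mem_set_image (s := Z i)]
  exact (Set.ext_iff.1 (hψ i) (e ∘ v)).symm

end OmegaStability

/-! ### Indiscernibility of trivial strictly minimal sets. -/

section StronglyMinimal

variable {L : FirstOrder.Language.{u, v}} {K : Type w} [L.Structure K] {A : Set K} {n : ℕ}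
  {X : Set (Fin n → K)}

theorem IsStronglyMinimal.definable (hX : IsStronglyMinimal L A X) : A.Definable L X := by
  obtain ⟨-, φ, hφ, -⟩ := hX
  exact definable_iff_exists_formula_sum.2 ⟨φ, hφ⟩

/-- Definable subsets of a strongly minimal set are finite or cofinite. -/
theorem IsStronglyMinimal.finite_or_cofinite (hX : IsStronglyMinimal L A X)
    {Y : Set (Fin n → K)} (hYX : Y ⊆ X) (hY : (univ : Set K).Definable L Y) :
    Y.Finite ∨ (X \ Y).Finite := by
  obtain ⟨-, φ, hφ, hsm⟩ := hX
  let N : Type (max u v w) := ULift.{max u v} K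
  let e₀ : K ≃ N := Equiv.ulift.symm
  let : L.Structure N := e₀.inducedStructure
  let e : K ≃[L] N := e₀.inducedStructureEquiv
  have hinj : Function.Injective (fun v : Fin n → K => e ∘ v) := e.injective.comp_left
  have hreal : ∀ v : Fin n → K, φ.Realize (Sum.elim (fun a : A => e a) (e ∘ v)) ↔ v ∈ X := by
    intro v
    rw [hφ, mem_ofPred_eq, ← StrongHomClass.realize_formula e φ]
    congr! 1
    funext c
    rcases c with c | c <;> rfl
  have := hsm N e.toElementaryEmbedding ((fun v : Fin n → K => e ∘ v) '' Y)
    (by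
      rintro _ ⟨v, hv, rfl⟩
      exact (hreal v).2 (hYX hv))
    ((definable_image_equiv e hY).mono (subset_univ _))
  refine this.imp (fun h => h.of_finite_image hinj.injOn) fun h => ?_
  refine Finite.of_finite_image (f := fun v : Fin n → K => e ∘ v) (h.subset ?_) hinj.injOn
  rintro _ ⟨v, hv, rfl⟩
  exact ⟨(hreal v).2 hv.1, fun h' => hv.2 (hinj.mem_set_image.1 h')⟩

/-- Triviality reduces closure to single points, where strict minimality adds nothing; the empty set
is covered by `acl(A) ∩ X = ∅`. -/
theorem aclIn_eq_self (hX : IsStrictlyMinimal L A X) (hXtriv : HasTrivialGeometry L A X)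
    {B : Set (Fin n → K)} (hB : B ⊆ X) : aclIn L A X B = B := by
  rcases B.eq_empty_or_nonempty with rfl | hne
  · exact hX.2.1
  · rw [hXtriv B hB hne]
    ext x
    simp only [mem_iUnion]
    constructor
    · rintro ⟨b, hb, hx⟩
      rw [hX.2.2 b (hB hb)] at hx
      rwa [mem_singleton_iff.1 hx]
    · intro hx
      refine ⟨x, hx, ?_⟩
      rw [hX.2.2 x (hB hx)]
      rfl

/-- A finite subset of a trivial strictly minimal set lies in its set of parameters. -/
theorem subset_of_finite_definable (hX : IsStrictlyMinimal L A X)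
    (hXtriv : HasTrivialGeometry L A X) {B Y : Set (Fin n → K)} (hB : B ⊆ X) (hYX : Y ⊆ X)
    (hY : (A ∪ coords B).Definable L Y) (hfin : Y.Finite) : Y ⊆ B := by
  intro x hx
  rw [← aclIn_eq_self hX hXtriv hB]
  exact ⟨hYX hx, mem_acl_of_finite_definable hY hfin hx⟩

/-- Any two tuples of distinct elements of a trivial strictly minimal set lie in the same
`A`-definable sets. -/
theorem mem_of_injective_fin (hX : IsStrictlyMinimal L A X) (hXtriv : HasTrivialGeometry L A X) :
    ∀ (m : ℕ) (D : Set (Fin m × Fin n → K)), A.Definable L D →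
      ∀ g g' : Fin m → Fin n → K, Function.Injective g → Function.Injective g' →
        (∀ i, g i ∈ X) → (∀ i, g' i ∈ X) → (fun q => g q.1 q.2) ∈ D → (fun q => g' q.1 q.2) ∈ D := by
  intro m
  induction m with
  | zero =>
    intro D _ g g' _ _ _ _ h
    rwa [Subsingleton.elim g' g]
  | succ m ih =>
    intro D hD g g' hg hg' hgX hgX' h
    let σ : Fin (m + 1) × Fin n → Fin n ⊕ (Fin m × Fin n) := fun q =>
      Fin.cases (motive := fun _ => Fin n ⊕ (Fin m × Fin n)) (Sum.inl q.2)
        (fun i => Sum.inr (i, q.2)) q.1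
    have hswap : ∀ (x : Fin n → K) (w : Fin m × Fin n → K),
        Sum.elim w x ∘ Sum.swap = Sum.elim x w := by
      intro x w
      funext c
      rcases c with c | c <;> rfl
    have hσ : ∀ (x : Fin n → K) (w : Fin m × Fin n → K),
        (Sum.elim x w) ∘ σ = fun q => Fin.cases (motive := fun _ => Fin n → K) x
          (fun i j => w (i, j)) q.1 q.2 := by
      intro x w
      funext ⟨i, j⟩
      refine Fin.cases ?_ (fun i => ?_) i <;> rfl
    have hXdef := hX.1.definable
    let P : Set (Fin n ⊕ (Fin m × Fin n) → K) :=
      (fun w => w ∘ Sum.inl) ⁻¹' X ∩ (fun w => w ∘ σ) ⁻¹' D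
    have hP : A.Definable L P := (hXdef.preimage_comp _).inter (hD.preimage_comp _)
    -- Besides `P`, the new point must differ from all the others; this keeps the witness `x₀` below
    -- outside `B`.
    let Q : Set ((Fin m × Fin n) ⊕ Fin n → K) :=
      (fun w => w ∘ Sum.swap) ⁻¹' (P ∩ ⋂ i : Fin m, (⋂ j : Fin n,
        {w : Fin n ⊕ (Fin m × Fin n) → K | w (Sum.inl j) = w (Sum.inr (i, j))})ᶜ)
    have hQ : A.Definable L Q := by
      refine Definable.preimage_comp _ (hP.inter (definable_iInter_of_finite fun i =>
        (definable_iInter_of_finite fun j => ?_).compl))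
      exact (Definable.diagonal L A).preimage_comp
        (![Sum.inl j, Sum.inr (i, j)] : Fin 2 → Fin n ⊕ (Fin m × Fin n))
    have hQ' : ∀ (x : Fin n → K) (b : Fin m → Fin n → K),
        Sum.elim (fun q : Fin m × Fin n => b q.1 q.2) x ∈ Q ↔
          (x ∈ X ∧ (fun q : Fin (m + 1) × Fin n => Fin.cases (motive := fun _ => Fin n → K) x b q.1 q.2) ∈ D) ∧
            ∀ i, x ≠ b i := by
      intro x b
      simp only [Q, P, mem_preimage, mem_inter_iff, mem_iInter, mem_compl_iff, mem_ofPred_eq,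
        hswap, hσ, Ne, funext_iff]
      rfl
    have hsplit : ∀ f : Fin (m + 1) → Fin n → K,
        (fun i => Fin.cases (motive := fun _ => Fin n → K) (f 0) (fun i => f i.succ) i) = f := by
      intro f
      funext i
      refine Fin.cases ?_ (fun i => ?_) i <;> rfl
    have hg0 : Sum.elim (fun q : Fin m × Fin n => g q.1.succ q.2) (g 0) ∈ Q := by
      refine (hQ' (g 0) fun i => g i.succ).2 ⟨⟨hgX 0, ?_⟩, fun i hi => ?_⟩
      · have := hsplit g
        simp only [funext_iff] at this
        convert! h using 1
        funext q
        exact this q.1 q.2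
      · exact (Fin.succ_ne_zero i).symm (hg hi)
    -- The projection of `Q` forgetting the first point is `A`-definable, so the induction
    -- hypothesis moves it from the tail of `g` to that of `g'`.
    obtain ⟨x₀, hx₀⟩ := ih _ hQ.exists_of_finite (fun i => g i.succ) (fun i => g' i.succ)
      (hg.comp (Fin.succ_injective m)) (hg'.comp (Fin.succ_injective m)) (fun i => hgX _)
      (fun i => hgX' _) ⟨g 0, hg0⟩
    obtain ⟨hx₀P, hx₀n⟩ := (hQ' x₀ fun i => g' i.succ).1 hx₀
    let B : Set (Fin n → K) := range fun i : Fin m => g' i.succ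
    have hBX : B ⊆ X := by
      rintro _ ⟨i, rfl⟩
      exact hgX' _
    let Y : Set (Fin n → K) := {x | Sum.elim x (fun q : Fin m × Fin n => g' q.1.succ q.2) ∈ P}
    have hYX : Y ⊆ X := fun x hx => hx.1
    have hY : (A ∪ coords B).Definable L Y := by
      refine (definable_fiber hP _).mono (union_subset_union_right A ?_)
      rintro _ ⟨q, rfl⟩
      exact ⟨_, ⟨q.1, rfl⟩, q.2, rfl⟩
    have hYmem : ∀ x, x ∈ Y ↔ x ∈ X ∧ (fun q : Fin (m + 1) × Fin n =>
        Fin.cases (motive := fun _ => Fin n → K) x (fun i => g' i.succ) q.1 q.2) ∈ D := by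
      intro x
      simp only [Y, P, mem_ofPred_eq, mem_inter_iff, mem_preimage, hσ]
      rfl
    -- A finite `Y` would lie in `B`, which `x₀` forbids. If `Y` is cofinite, its complement in `X`
    -- lies in `B`, and `g' 0 ∉ B`.
    have hg'Y : g' 0 ∈ Y := by
      rcases hX.1.finite_or_cofinite hYX (hY.mono (subset_univ _)) with hf | hf
      · obtain ⟨i, hi⟩ := subset_of_finite_definable hX hXtriv hBX hYX hY hf ((hYmem x₀).2 hx₀P)
        exact absurd hi.symm (hx₀n i)
      · by_contra hn
        obtain ⟨i, hi⟩ := subset_of_finite_definable hX hXtriv hBX sdiff_subset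
          ((hXdef.mono subset_union_left).sdiff hY) hf ⟨hgX' 0, hn⟩
        exact Fin.succ_ne_zero i (hg' hi)
    have h2 := ((hYmem _).1 hg'Y).2
    have := hsplit g'
    simp only [funext_iff] at this
    convert! h2 using 1
    funext q
    exact (this q.1 q.2).symm

/-- Any two families of distinct elements of a trivial strictly minimal set, with the same finite
index type, lie in the same `A`-definable sets. -/
theorem mem_of_injective (hX : IsStrictlyMinimal L A X) (hXtriv : HasTrivialGeometry L A X)
    {ι : Type*} [Finite ι] {D : Set (ι × Fin n → K)} (hD : A.Definable L D)
    {g g' : ι → Fin n → K} (hg : Function.Injective g) (hg' : Function.Injective g')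
    (hgX : ∀ i, g i ∈ X) (hgX' : ∀ i, g' i ∈ X) (h : (fun q => g q.1 q.2) ∈ D) :
    (fun q => g' q.1 q.2) ∈ D := by
  obtain ⟨m, ⟨e⟩⟩ := Finite.exists_equiv_fin ι
  have hD' := hD.preimage_comp (Prod.map e id : ι × Fin n → Fin m × Fin n)
  have key : ∀ f : ι → Fin n → K,
      (fun q : Fin m × Fin n => f (e.symm q.1) q.2) ∘ (Prod.map e id : ι × Fin n → Fin m × Fin n)
        = fun q => f q.1 q.2 := by
    intro f
    funext q
    simp
  have := mem_of_injective_fin hX hXtriv m _ hD' (g ∘ e.symm) (g' ∘ e.symm)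
    (hg.comp e.symm.injective) (hg'.comp e.symm.injective) (fun i => hgX _) (fun i => hgX' _)
    (by
      rw [mem_preimage]
      exact (key g).symm ▸ h)
  rw [mem_preimage] at this
  exact key g' ▸ this

end StronglyMinimal

/-! ### Equivalence relations definable from equality alone. -/

section PureEquality

variable {S : Type w} {E : Setoid S}

theorem definable₂_of_finite (L : FirstOrder.Language) [L.Structure S] {D : Set (S × S)}
    (hD : D.Finite) : (univ : Set S).Definable₂ L D := by
  have hpt : ∀ p : S × S, (univ : Set S).Definable L {x : Fin 2 → S | (x 0, x 1) = p} := by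
    intro p
    have h := ((Definable.singleton_of_mem L (mem_univ p.1)).preimage_comp
      (![0] : Fin 1 → Fin 2)).inter
      ((Definable.singleton_of_mem L (mem_univ p.2)).preimage_comp (![1] : Fin 1 → Fin 2))
    convert! h using 1
    ext x
    exact Prod.ext_iff
  have h := definable_biUnion_finset (L := L) hpt hD.toFinset
  unfold Definable₂
  convert! h using 1
  ext x
  simp

/-- With `C` the class of `a`, the relation is `C × C` together with a finite relation on the finite
complement of `C`. -/
theorem isTrivialRel_of_finite_compl_class (a : S) (h : {x | ¬ E a x}.Finite) :
    IsTrivialRel (fun x y => E x y) := by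
  let : FirstOrder.Language.empty.Structure S := FirstOrder.Language.emptyStructure
  let L := FirstOrder.Language.empty
  change (univ : Set S).Definable₂ L {p : S × S | E p.1 p.2}
  have hfin : (univ : Set S).Definable₂ L
      {p : S × S | (¬ E a p.1 ∧ ¬ E a p.2) ∧ E p.1 p.2} :=
    definable₂_of_finite L ((h.prod h).subset fun p hp => hp.1)
  -- The finite complement of the class is placed on the diagonal, so that the result on finite
  -- binary relations also defines it as a unary set.
  have hdiag : (univ : Set S).Definable₂ L {p : S × S | ¬ E a p.1 ∧ p.1 = p.2} := by
    refine definable₂_of_finite L ((h.prod h).subset ?_)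
    rintro p ⟨hx, hp⟩
    exact ⟨hx, hp ▸ hx⟩
  have hout : (univ : Set S).Definable L {x : Fin 1 → S | ¬ E a (x 0)} := by
    have := hdiag.preimage_comp (fun _ => 0 : Fin 2 → Fin 1)
    convert! this using 1
    ext x
    exact (and_iff_left rfl).symm
  have h' := ((hout.preimage_comp (![0] : Fin 1 → Fin 2)).compl.inter
    (hout.preimage_comp (![1] : Fin 1 → Fin 2)).compl).union hfin
  unfold Definable₂
  convert! h' using 1
  ext x
  change E (x 0) (x 1) ↔ (¬ ¬ E a (x 0) ∧ ¬ ¬ E a (x 1)) ∨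
    ((¬ E a (x 0) ∧ ¬ E a (x 1)) ∧ E (x 0) (x 1))
  constructor
  · intro hE
    by_cases ha : E a (x 0)
    · exact Or.inl ⟨not_not.2 ha, not_not.2 (E.trans ha hE)⟩
    · exact Or.inr ⟨⟨ha, fun h1 => ha (E.trans h1 (E.symm hE))⟩, hE⟩
  · rintro (⟨h0, h1⟩ | h)
    · exact E.trans (E.symm (not_not.1 h0)) (not_not.1 h1)
    · exact h.2

/-- The relation is the diagonal together with a finite set of pairs. -/
theorem isTrivialRel_of_finite_nonsingleton (h : {x | ∃ y, x ≠ y ∧ E x y}.Finite) :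
    IsTrivialRel (fun x y => E x y) := by
  let : FirstOrder.Language.empty.Structure S := FirstOrder.Language.emptyStructure
  let L := FirstOrder.Language.empty
  change (univ : Set S).Definable₂ L {p : S × S | E p.1 p.2}
  have hfin : (univ : Set S).Definable₂ L {p : S × S | p.1 ≠ p.2 ∧ E p.1 p.2} :=
    definable₂_of_finite L ((h.prod h).subset fun p hp =>
      ⟨⟨p.2, hp⟩, p.1, hp.1.symm, E.symm hp.2⟩)
  have h' := Definable.union (Definable.diagonal L (univ : Set S)) hfin
  unfold Definable₂
  convert! h' using 1
  ext x
  change E (x 0) (x 1) ↔ x 0 = x 1 ∨ (x 0 ≠ x 1 ∧ E (x 0) (x 1))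
  constructor
  · intro hE
    by_cases hx : x 0 = x 1
    · exact Or.inl hx
    · exact Or.inr ⟨hx, hE⟩
  · rintro (h | h)
    · rw [h]
    · exact h.2

/-- Infinitely many elements in finite non-singleton classes give infinitely many
non-singleton classes. -/
theorem exists_seq_of_infinite_nonsingleton (hfin : ∀ x, {y | E x y}.Finite)
    (hinf : {x | ∃ y, x ≠ y ∧ E x y}.Infinite) :
    ∃ x y : ℕ → S, (∀ i, x i ≠ y i) ∧ (∀ i, E (x i) (y i)) ∧ ∀ i j, E (x i) (x j) → i = j := by
  have himg : ((Quotient.mk E) '' {x | ∃ y, x ≠ y ∧ E x y}).Infinite := by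
    intro h
    refine hinf (Finite.of_finite_fibers (Quotient.mk E) h ?_)
    rintro _ ⟨x, -, rfl⟩
    refine (hfin x).subset fun y hy => ?_
    exact E.symm (Quotient.exact hy.2)
  let f := himg.natEmbedding
  choose x hx hfx using fun i => (f i).2
  choose y hne hxy using hx
  refine ⟨x, y, hne, hxy, fun i j hij => f.injective (Subtype.ext ?_)⟩
  rw [← hfx i, ← hfx j]
  exact Quotient.sound hij

end PureEquality

/-! ### Coding arbitrary patterns by a definable equivalence relation. -/

section Main

variable {L : FirstOrder.Language.{u, v}} {K : Type w} [L.Structure K] {A : Set K} {n : ℕ}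
  {X : Set (Fin n → K)}

/-- A definable equivalence relation on a trivial strictly minimal set in an ω-stable structure
does not have infinitely many non-singleton classes. -/
theorem not_exists_seq_nonsingleton (hK : IsOmegaStable L K) (hX : IsStrictlyMinimal L A X)
    (hXtriv : HasTrivialGeometry L A X) {E : Setoid X}
    (hE : RelDefinable L (fun x y : X => E x y)) {x y : ℕ → X} (hne : ∀ i, x i ≠ y i)
    (hxy : ∀ i, E (x i) (y i)) (hx : ∀ i j, E (x i) (x j) → i = j) : False := by
  classical
  obtain ⟨A₀, -, hA₀⟩ := definable_iff_finitely_definable.1 hE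
  obtain ⟨φ, hφ⟩ := definable_iff_exists_formula_sum.1 hA₀
  obtain ⟨k, ⟨e⟩⟩ := Finite.exists_equiv_fin (A₀ : Set K)
  let D : Set (Fin k ⊕ (Fin n ⊕ Fin n) → K) := {w | (φ.relabel (Sum.map e id)).Realize w}
  have hD : (∅ : Set K).Definable L D := empty_definable_iff.2 ⟨_, rfl⟩
  let z₀ : Fin k → K := fun i => e.symm i
  have hDE : ∀ a b : X, Sum.elim z₀ (Sum.elim (a : Fin n → K) b) ∈ D ↔ E a b := by
    intro a b
    have h1 : Sum.elim z₀ (Sum.elim (a : Fin n → K) b) ∈ D ↔ Sum.elim (a : Fin n → K) b ∈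
        {v | φ.Realize (Sum.elim (fun c : (A₀ : Set K) => (c : K)) v)} := by
      simp only [D, mem_ofPred_eq, Formula.realize_relabel]
      congr! 1
      funext c
      rcases c with c | c
      · simp [z₀]
      · rfl
    rw [h1, ← hφ]
    constructor
    · rintro ⟨_, _, h⟩
      exact h
    · exact fun h => ⟨a.2, b.2, h⟩
  -- Only even indices are used; the odd `x (2 * i + 1)` are kept as partners inequivalent to `x (2
  -- * i)`.
  let b : ℕ → Fin n ⊕ Fin n → K := fun i => Sum.elim (x (2 * i)) (y (2 * i))
  have : Nonempty K := by
    by_contra hemp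
    rw [not_nonempty_iff] at hemp
    rcases isEmpty_or_nonempty (Fin n) with hn | ⟨⟨j⟩⟩
    · exact hne 0 (Subtype.ext (Subsingleton.elim _ _))
    · exact hemp.elim ((x 0 : Fin n → K) j)
  refine hK.not_independent (C := ⋃ i, range (b i)) (countable_iUnion fun i => countable_range _)
    (Z := fun i => {z : Fin k → K | Sum.elim z (b i) ∈ D}) (fun i => ?_) ?_
  · refine (definable_fiber hD (b i)).mono ?_
    rw [empty_union]
    exact subset_iUnion (fun i => range (b i)) i
  intro S F
  let τ : F → Fin k ⊕ (Fin n ⊕ Fin n) → ((F × Bool) × Fin n) ⊕ Fin k := fun i =>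
    Sum.elim Sum.inr (Sum.elim (fun j => Sum.inl ((i, false), j)) fun j => Sum.inl ((i, true), j))
  let R : F → Set (((F × Bool) × Fin n) ⊕ Fin k → K) := fun i =>
    if (i : ℕ) ∈ S then (fun w => w ∘ τ i) ⁻¹' D else ((fun w => w ∘ τ i) ⁻¹' D)ᶜ
  have hR : ∀ i, A.Definable L (R i) := by
    intro i
    have h := (hD.mono (empty_subset A)).preimage_comp (τ i)
    dsimp only [R]
    split_ifs
    · exact h
    · exact h.compl
  have hτ : ∀ (g : F × Bool → Fin n → K) (z : Fin k → K) (i : F),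
      Sum.elim (fun q : (F × Bool) × Fin n => g q.1 q.2) z ∘ τ i =
        Sum.elim z (Sum.elim (g (i, false)) (g (i, true))) := by
    intro g z i
    funext c
    rcases c with c | c | c <;> rfl
  have hRmem : ∀ (g : F × Bool → Fin n → K) (z : Fin k → K),
      Sum.elim (fun q : (F × Bool) × Fin n => g q.1 q.2) z ∈ ⋂ i, R i ↔
        ∀ i : F, Sum.elim z (Sum.elim (g (i, false)) (g (i, true))) ∈ D ↔ (i : ℕ) ∈ S := by
    intro g z
    rw [mem_iInter]
    refine forall_congr' fun i => ?_
    dsimp only [R]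
    split_ifs with hi
    · rw [mem_preimage, hτ, iff_true_right hi]
    · rw [mem_compl_iff, mem_preimage, hτ, iff_false_right hi]
  have hxinj : ∀ {i j}, x i = x j → i = j := fun {i j} h => hx i j (h ▸ E.refl _)
  have hyE : ∀ {i j}, y i = x j → i = j := fun {i j} h => hx i j (h ▸ hxy i)
  have hyinj : ∀ {i j}, y i = y j → i = j := fun {i j} h =>
    hx i j (E.trans (hxy i) (h ▸ E.symm (hxy j)))
  -- `g₀` realizes the pattern `S` with the original parameters `z₀`: its `i`-th pair is equivalent
  -- exactly when `i ∈ S`. `g₁` lists the fixed pairs `b i`.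
  let g₀ : F × Bool → X := fun q => if q.2 then (if (q.1 : ℕ) ∈ S then y (2 * q.1)
    else x (2 * q.1 + 1)) else x (2 * q.1)
  let g₁ : F × Bool → X := fun q => if q.2 then y (2 * q.1) else x (2 * q.1)
  have hg₁ : Function.Injective g₁ := by
    rintro ⟨i, s⟩ ⟨j, t⟩ h
    have hij : (i : ℕ) = j := by
      cases s <;> cases t <;> simp only [g₁, if_true, Bool.false_eq_true, if_false] at h
      · have := hxinj h; omega
      · have := hyE h.symm; omega
      · have := hyE h; omega
      · have := hyinj h; omega
    obtain rfl : i = j := Subtype.ext hij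
    cases s <;> cases t <;> simp only [g₁, if_true, Bool.false_eq_true, if_false] at h
    · rfl
    · exact absurd h (hne _)
    · exact absurd h.symm (hne _)
    · rfl
  have hg₀ : Function.Injective g₀ := by
    rintro ⟨i, s⟩ ⟨j, t⟩ h
    have hij : (i : ℕ) = j := by
      cases s <;> cases t <;> simp only [g₀, if_true, Bool.false_eq_true, if_false] at h
      · have := hxinj h; omega
      · split_ifs at h
        · have := hyE h.symm; omega
        · have := hxinj h; omega
      · split_ifs at h
        · have := hyE h; omega
        · have := hxinj h; omega
      · split_ifs at h
        · have := hyinj h; omega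
        · have := hyE h; omega
        · have := hyE h.symm; omega
        · have := hxinj h; omega
    obtain rfl : i = j := Subtype.ext hij
    cases s <;> cases t <;> simp only [g₀, if_true, Bool.false_eq_true, if_false] at h
    · rfl
    · split_ifs at h
      · exact absurd h (hne _)
      · have := hxinj h; omega
    · split_ifs at h
      · exact absurd h.symm (hne _)
      · have := hxinj h; omega
    · rfl
  -- "Some `z` realizes the pattern" is a condition over `A` on the family of points, so it passes
  -- from `g₀` to `g₁`.
  obtain ⟨z, hz⟩ := mem_of_injective hX hXtriv (definable_iInter_of_finite hR).exists_of_finite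
    (Subtype.val_injective.comp hg₀) (Subtype.val_injective.comp hg₁) (fun i => (g₀ i).2)
    (fun i => (g₁ i).2) ⟨z₀, (hRmem (fun q => g₀ q) z₀).2 fun i => by
      rw [hDE]
      by_cases hi : (i : ℕ) ∈ S
      · simpa [g₀, hi] using hxy _
      · simp only [g₀, hi, if_true, Bool.false_eq_true, if_false, iff_false]
        intro h
        have := hx _ _ h
        omega⟩
  refine ⟨z, fun i hi => ?_⟩
  exact (hRmem (fun q => g₁ q) z).1 hz ⟨i, hi⟩

/-- The classes of a definable equivalence relation on a strongly minimal set are finite or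
cofinite. -/
theorem IsStronglyMinimal.class_finite_or_cofinite (hX : IsStronglyMinimal L A X) {E : Setoid X}
    (hE : RelDefinable L (fun x y : X => E x y)) (a : X) :
    {y | E a y}.Finite ∨ {y | ¬ E a y}.Finite := by
  have hdef := definable_fiber (hE.preimage_comp Sum.swap) (a : Fin n → K)
  rw [univ_union] at hdef
  have himg : {v : Fin n → K | Sum.elim v (a : Fin n → K) ∈ (fun g => g ∘ Sum.swap) ⁻¹'
      {z : Fin n ⊕ Fin n → K | ∃ (hx : z ∘ Sum.inl ∈ X) (hy : z ∘ Sum.inr ∈ X),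
        E ⟨z ∘ Sum.inl, hx⟩ ⟨z ∘ Sum.inr, hy⟩}} = Subtype.val '' {y : X | E a y} := by
    ext v
    constructor
    · rintro ⟨_, hv, h⟩
      exact ⟨⟨v, hv⟩, h, rfl⟩
    · rintro ⟨y, hy, rfl⟩
      exact ⟨a.2, y.2, hy⟩
  rw [himg] at hdef
  refine (hX.finite_or_cofinite (by simp) hdef).imp
    (fun h => h.of_finite_image Subtype.val_injective.injOn) fun h => ?_
  refine Finite.of_finite_image (f := Subtype.val) (h.subset ?_) Subtype.val_injective.injOn
  rintro _ ⟨y, hy, rfl⟩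
  exact ⟨y.2, fun h' => hy (Subtype.val_injective.mem_set_image.1 h')⟩

end Main

end OmegaStable

theorem mainTheorem5 (L : FirstOrder.Language.{u, v}) (K : Type w) [L.Structure K]
    (hK : OmegaStable.IsOmegaStable L K)
    (A : Set K) (n : ℕ) (X : Set (Fin n → K))
    (hX : OmegaStable.IsStrictlyMinimal L A X)
    (hXtriv : OmegaStable.HasTrivialGeometry L A X)
    (E : Setoid X) (hE : OmegaStable.RelDefinable L (fun x y : X => E x y)) :
    OmegaStable.IsTrivialRel (fun x y : X => E x y) := by
  by_cases hcof : ∃ a : X, {y | ¬ E a y}.Finite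
  · obtain ⟨a, ha⟩ := hcof
    exact OmegaStable.isTrivialRel_of_finite_compl_class a ha
  by_cases hns : {x : X | ∃ y, x ≠ y ∧ E x y}.Finite
  · exact OmegaStable.isTrivialRel_of_finite_nonsingleton hns
  obtain ⟨x, y, hne, hxy, hx⟩ := OmegaStable.exists_seq_of_infinite_nonsingleton
    (fun a => (hX.1.class_finite_or_cofinite hE a).resolve_right fun h => hcof ⟨a, h⟩) hns
  exact (OmegaStable.not_exists_seq_nonsingleton hK hX hXtriv hE hne hxy hx).elim
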